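/- Let $k\ge 1$ be an integer and let $G$ be a finite simple graph that is a $k$-tree, i.e. $G$ is obtained from a complete graph on $k+1$ vertices by repeatedly adding a new vertex whose neighbours are exactly the vertices of some $k$-clique of the graph built so far. Call a spanning tree of maximum total weight in the clique-intersection graph of $G$ a clique tree of $G$; here the clique-intersection graph has the (inclusion-)maximal cliques of $G$ as vertices, two distinct maximal cliques $Q,Q'$ being joined by an edge of weight $|Q\cap Q'|$ whenever $Q\cap Q'\neq\emptyset$. Let $C_r(G)$ be the reduced clique graph of $G$: its vertices are the maximal cliques of $G$, and two distinct maximal cliques $Q,Q'$ are adjacent if and only if $Q\cap Q'\ne\emptyset$ and every path in $G$ from a vertex of $Q\setminus Q'$ to a vertex of $Q'\setminus Q$ contains a vertex of $Q\cap Q'$. Let $\ell_{k+1}(G)$ be the $(k+1)$-line graph of $G$: its vertices are the cliques of $G$ with exactly $k+1$ vertices, two distinct ones being adjacent if and only if they have exactly $k$ vertices in common. Then the number of clique trees of $G$ equals the number of spanning trees of $C_r(G)$, and it also equals the number of spanning trees of $\ell_{k+1}(G)$. (Trees are counted as labelled trees, that is, as edge sets.) -/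

import Mathlib

namespace KTree

variable {V : Type*}

/-- `IsKTreeOn G k s` says that the induced subgraph `G[s]` is a `k`-tree, by the recursive
definition: a complete graph on `k + 1` vertices is a `k`-tree, and so is every graph obtained
from a `k`-tree by adding a new vertex `v` whose neighbours are exactly the vertices of a
`k`-clique `C` of the existing `k`-tree. -/
inductive IsKTreeOn [DecidableEq V] (G : SimpleGraph V) (k : ℕ) : Finset V → Prop
  | base (s : Finset V) (hs : G.IsNClique (k + 1) s) : IsKTreeOn G k s
  | step (s C : Finset V) (v : V) (hs : IsKTreeOn G k s) (hv : v ∉ s) (hCs : C ⊆ s)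
      (hC : G.IsNClique k C) (hadj : ∀ w ∈ s, G.Adj v w ↔ w ∈ C) :
      IsKTreeOn G k (insert v s)

/-- The finite graph `G` is a `k`-tree. -/
def IsKTree [Fintype V] [DecidableEq V] (G : SimpleGraph V) (k : ℕ) : Prop :=
  IsKTreeOn G k Finset.univ

/-- The maximal (with respect to inclusion) cliques of `G`. -/
abbrev MaxClique (G : SimpleGraph V) : Type _ :=
  {Q : Finset V // Maximal (fun s : Finset V => G.IsClique (s : Set V)) Q}

/-- The spanning trees of a graph `H` (as labelled trees): the trees on the whole vertex set of
`H` all of whose edges are edges of `H`. -/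
def spanningTrees {W : Type*} (H : SimpleGraph W) : Set (SimpleGraph W) :=
  {T | T ≤ H ∧ T.IsTree}

/-- The clique-intersection graph: its vertices are the maximal cliques of `G`, and two distinct
maximal cliques are adjacent when they are not disjoint. -/
def cliqueIntersectionGraph [DecidableEq V] (G : SimpleGraph V) :
    SimpleGraph (MaxClique G) where
  Adj Q Q' := Q ≠ Q' ∧ (Q.1 ∩ Q'.1).Nonempty
  symm := ⟨fun _ _ h => ⟨h.1.symm, by rw [Finset.inter_comm]; exact h.2⟩⟩
  loopless := ⟨fun _ h => h.1 rfl⟩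

/-- The weight of the (potential) edge `{Q, Q'}`, namely `|Q ∩ Q'|`. -/
def edgeWeight [DecidableEq V] (G : SimpleGraph V) : Sym2 (MaxClique G) → ℕ :=
  Sym2.lift ⟨fun Q Q' => (Q.1 ∩ Q'.1).card, fun Q Q' =>
    congrArg Finset.card (Finset.inter_comm Q.1 Q'.1)⟩

open Classical in
/-- The total weight of a graph on the maximal cliques of `G`: the sum of its edge weights. -/
noncomputable def totalWeight [Fintype V] [DecidableEq V] (G : SimpleGraph V)
    (T : SimpleGraph (MaxClique G)) : ℕ :=
  ∑ e ∈ T.edgeFinset, edgeWeight G e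

/-- The clique trees of `G`: the maximum-weight spanning trees of its clique-intersection
graph. -/
def cliqueTrees [Fintype V] [DecidableEq V] (G : SimpleGraph V) :
    Set (SimpleGraph (MaxClique G)) :=
  {T | T ∈ spanningTrees (cliqueIntersectionGraph G) ∧
    ∀ T' ∈ spanningTrees (cliqueIntersectionGraph G), totalWeight G T' ≤ totalWeight G T}

/-- `Q` and `Q'` form a separating pair: they are not disjoint, and every path of `G` from a
vertex of `Q \ Q'` to a vertex of `Q' \ Q` contains a vertex of `Q ∩ Q'`. -/
def IsSeparatingPair [DecidableEq V] (G : SimpleGraph V) (Q Q' : Finset V) : Prop :=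
  (Q ∩ Q').Nonempty ∧
    ∀ u ∈ Q \ Q', ∀ v ∈ Q' \ Q, ∀ p : G.Walk u v, p.IsPath → ∃ x ∈ p.support, x ∈ Q ∩ Q'

theorem IsSeparatingPair.symm [DecidableEq V] {G : SimpleGraph V} {Q Q' : Finset V}
    (h : IsSeparatingPair G Q Q') : IsSeparatingPair G Q' Q := by
  refine ⟨by rw [Finset.inter_comm]; exact h.1, fun u hu v hv p hp => ?_⟩
  obtain ⟨x, hx, hxQ⟩ := h.2 v hv u hu p.reverse hp.reverse
  exact ⟨x, by simpa using hx, by rw [Finset.inter_comm]; exact hxQ⟩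

/-- The reduced clique graph `C_r(G)`: its vertices are the maximal cliques of `G`, and two
distinct maximal cliques are adjacent when they form a separating pair. -/
def reducedCliqueGraph [DecidableEq V] (G : SimpleGraph V) : SimpleGraph (MaxClique G) where
  Adj Q Q' := Q ≠ Q' ∧ IsSeparatingPair G Q.1 Q'.1
  symm := ⟨fun _ _ h => ⟨h.1.symm, h.2.symm⟩⟩
  loopless := ⟨fun _ h => h.1 rfl⟩

/-- The `m`-line graph of `G`: its vertices are the `m`-cliques of `G`, and two distinct
`m`-cliques are adjacent when they have exactly `m - 1` vertices in common. -/
def lineGraph [DecidableEq V] (G : SimpleGraph V) (m : ℕ) :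
    SimpleGraph {s : Finset V // G.IsNClique m s} where
  Adj s t := s ≠ t ∧ (s.1 ∩ t.1).card + 1 = m
  symm := ⟨fun _ _ h => ⟨h.1.symm, by rw [Finset.inter_comm]; exact h.2⟩⟩
  loopless := ⟨fun _ h => h.1 rfl⟩

end KTree

/-! The maximal cliques of a `k`-tree are its `(k + 1)`-cliques, so distinct ones share at most `k`
vertices. Fewer than `k` vertices never separate a `k`-tree (`exists_walk_avoiding`), while `k`
common vertices of two `(k + 1)`-cliques do (`exists_separation`). Hence separating pairs are
exactly the pairs with intersection of size `k`, and `C_r(G)` is the `(k + 1)`-line graph. On `n`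
maximal cliques a spanning tree has `n - 1` edges of weight at most `k`, so weight at most `(n - 1)
* k`, with equality iff all its edges lie in `C_r(G)`. The line graph is connected, so the bound is
attained and the clique trees are the spanning trees of `C_r(G)`. -/

namespace KTree

/-! ### Cliques and separators, by induction on the construction of a `k`-tree. -/

section Structure

variable {V : Type*} [DecidableEq V] {G : SimpleGraph V} {k : ℕ} {s : Finset V}

/-- A clique through a vertex `v` lies in `v` together with the neighbours of `v`. -/
theorem subset_insert_of_isClique {C K : Finset V} {v : V} (hK : G.IsClique (K : Set V))
    (hKs : K ⊆ insert v s) (hvK : v ∈ K) (hadj : ∀ w ∈ s, G.Adj v w ↔ w ∈ C) :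
    K ⊆ insert v C := by
  intro x hx
  by_cases hxv : x = v
  · simp [hxv]
  · have hxs : x ∈ s := by simpa [hxv] using hKs hx
    exact Finset.mem_insert_of_mem ((hadj x hxs).1 (hK hvK hx (Ne.symm hxv)))

/-- The clique created when a vertex is attached to a clique. -/
theorem isNClique_insert_of_forall_adj {C : Finset V} {v : V} (hCs : C ⊆ s)
    (hC : G.IsNClique k C) (hadj : ∀ w ∈ s, G.Adj v w ↔ w ∈ C) :
    G.IsNClique (k + 1) (insert v C) :=
  hC.insert fun w hw => (hadj w (hCs hw)).2 hw

/-- In a `k`-tree, every clique extends to a `(k + 1)`-clique. -/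
theorem IsKTreeOn.exists_isNClique_superset (h : IsKTreeOn G k s) :
    ∀ K ⊆ s, G.IsClique (K : Set V) → ∃ Q ⊆ s, K ⊆ Q ∧ G.IsNClique (k + 1) Q := by
  induction h with
  | base s hs => exact fun K hK _ => ⟨s, subset_rfl, hK, hs⟩
  | step s C v hs hv hCs hC hadj ih =>
    intro K hK hKc
    by_cases hvK : v ∈ K
    · exact ⟨insert v C, Finset.insert_subset_insert _ hCs,
        subset_insert_of_isClique hKc hK hvK hadj, isNClique_insert_of_forall_adj hCs hC hadj⟩
    · obtain ⟨Q, hQs, hKQ, hQ⟩ := ih K ((Finset.subset_insert_iff_of_notMem hvK).1 hK) hKc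
      exact ⟨Q, hQs.trans (Finset.subset_insert _ _), hKQ, hQ⟩

theorem IsKTreeOn.card_le_of_isClique (h : IsKTreeOn G k s) {K : Finset V} (hKs : K ⊆ s)
    (hK : G.IsClique (K : Set V)) : K.card ≤ k + 1 := by
  obtain ⟨Q, -, hKQ, hQ⟩ := h.exists_isNClique_superset K hKs hK
  exact hQ.card_eq ▸ Finset.card_le_card hKQ

/-- A `k`-tree stays connected when fewer than `k` vertices are deleted. -/
theorem IsKTreeOn.exists_walk_avoiding (h : IsKTreeOn G k s) {S : Finset V} (hS : S.card < k) :
    ∀ u ∈ s \ S, ∀ w ∈ s \ S, ∃ p : G.Walk u w, ∀ x ∈ p.support, x ∉ S := by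
  induction h with
  | base s hs =>
    intro u hu w hw
    rw [Finset.mem_sdiff] at hu hw
    by_cases huw : u = w
    · subst huw
      exact ⟨.nil, by simpa using hu.2⟩
    · exact ⟨(hs.isClique hu.1 hw.1 huw).toWalk, by simp [hu.2, hw.2]⟩
  | step s C v hs hv hCs hC hadj ih =>
    -- As `C` has `k` vertices, one of them survives the deletion of `S` and links `v` to the old
    -- graph.
    obtain ⟨c, hcC, hcS⟩ := Finset.exists_mem_notMem_of_card_lt_card (hC.card_eq.symm ▸ hS)
    have hvc : G.Adj v c := (hadj c (hCs hcC)).2 hcC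
    have hub : v ∉ S → ∀ w ∈ s \ S, ∃ p : G.Walk v w, ∀ x ∈ p.support, x ∉ S := by
      intro hvS w hw
      obtain ⟨p, hp⟩ := ih c (Finset.mem_sdiff.2 ⟨hCs hcC, hcS⟩) w hw
      exact ⟨.cons hvc p, by simpa [hvS] using hp⟩
    intro u hu w hw
    rw [Finset.mem_sdiff, Finset.mem_insert] at hu hw
    obtain ⟨hu, huS⟩ := hu
    obtain ⟨hw, hwS⟩ := hw
    rcases hu with rfl | hu <;> rcases hw with rfl | hw
    · exact ⟨.nil, by simpa using huS⟩
    · exact hub huS w (Finset.mem_sdiff.2 ⟨hw, hwS⟩)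
    · obtain ⟨p, hp⟩ := hub hwS u (Finset.mem_sdiff.2 ⟨hu, huS⟩)
      exact ⟨p.reverse, by simpa using hp⟩
    · exact ih u (Finset.mem_sdiff.2 ⟨hu, huS⟩) w (Finset.mem_sdiff.2 ⟨hw, hwS⟩)

/-- In a `k`-tree, two `(k + 1)`-cliques `S ∪ {u}` and `S ∪ {w}` are separated by `S`: there is a
union `A` of components of the complement of `S` containing `u` but not `w`. -/
theorem IsKTreeOn.exists_separation (h : IsKTreeOn G k s) {S : Finset V} {u w : V}
    (hS : S.card = k) (huS : u ∉ S) (hwS : w ∉ S) (huw : u ≠ w)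
    (hu : G.IsClique (insert u S : Finset V)) (hw : G.IsClique (insert w S : Finset V)) :
    insert u S ⊆ s → insert w S ⊆ s →
      ∃ A ⊆ s, u ∈ A ∧ w ∉ A ∧ ∀ a ∈ A, ∀ b ∈ s, G.Adj a b → b ∈ A ∨ b ∈ S := by
  induction h with
  | base s hs =>
    intro hus hws
    have h1 : insert u S = s := Finset.eq_of_subset_of_card_le hus (by
      rw [hs.card_eq, Finset.card_insert_of_notMem huS, hS])
    have h2 : w ∈ insert u S := h1 ▸ hws (Finset.mem_insert_self _ _)
    simp [huw.symm, hwS] at h2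
  | step s C v hs hv hCs hC hadj ih =>
    intro hus hws
    have key : ∀ x, insert x S ⊆ insert v s → x = v → x ∉ S →
        G.IsClique (insert x S : Finset V) → S = C := by
      rintro x hxs rfl hxS hx
      refine Finset.eq_of_subset_of_card_le (fun y hy => ?_) (by rw [hC.card_eq, hS])
      have := subset_insert_of_isClique hx hxs (by simp) hadj (Finset.mem_insert_of_mem hy)
      rw [Finset.mem_insert] at this
      exact this.resolve_left (by rintro rfl; exact hxS hy)
    by_cases huv : u = v
    · have hSC := key u hus huv huS hu
      subst huv hSC
      -- The new vertex `u` has all its neighbours in `S = C`, so it is cut off alone.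
      refine ⟨{u}, by simp, by simp, by simpa using huw.symm, ?_⟩
      intro a ha b hb hab
      rw [Finset.mem_singleton] at ha ⊢
      subst ha
      exact (Finset.mem_insert.1 hb).imp_right fun hb => (hadj b hb).1 hab
    by_cases hwv : w = v
    · have hSC := key w hws hwv hwS hw
      subst hwv hSC
      have hus' : u ∈ s := by simpa [huv] using hus (Finset.mem_insert_self _ _)
      -- Now `w` is the vertex cut off by `S`, so every other vertex outside `S` can go into `A`.
      refine ⟨s \ S, Finset.sdiff_subset.trans (Finset.subset_insert _ _), by simp [hus', huS],
        by simp [hv], ?_⟩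
      intro a ha b hb hab
      rw [Finset.mem_sdiff] at ha ⊢
      rcases Finset.mem_insert.1 hb with rfl | hb
      · exact absurd ((hadj a ha.1).1 hab.symm) ha.2
      · tauto
    have hus' : u ∈ s := by simpa [huv] using hus (Finset.mem_insert_self _ _)
    have hws' : w ∈ s := by simpa [hwv] using hws (Finset.mem_insert_self _ _)
    -- This case is impossible: both cliques would contain `v` and so equal `insert v C`, the only
    -- `(k + 1)`-clique through `v`.
    by_cases hvS : v ∈ S
    · have hmem : ∀ x, G.IsClique (insert x S : Finset V) → insert x S ⊆ insert v s → x ≠ v →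
          insert x (S.erase v) ⊆ C := by
        intro x hx hxs hxv y hy
        have hyv : y ≠ v := by
          rintro rfl
          simp [Ne.symm hxv] at hy
        have hyS : y ∈ insert x S := by
          rw [Finset.mem_insert, Finset.mem_erase] at hy
          rw [Finset.mem_insert]
          tauto
        have := subset_insert_of_isClique hx hxs (Finset.mem_insert_of_mem hvS) hadj hyS
        exact (Finset.mem_insert.1 this).resolve_left hyv
      have h1 : insert u (S.erase v) = C :=
        Finset.eq_of_subset_of_card_le (hmem u hu hus huv) (by
          rw [Finset.card_insert_of_notMem (by simp [huS]), Finset.card_erase_add_one hvS,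
            hS, hC.card_eq])
      have h2 : w ∈ insert u (S.erase v) := h1 ▸ hmem w hw hws hwv (Finset.mem_insert_self _ _)
      simp [huw.symm, hwS] at h2
    have hnot : ∀ x, insert x S ⊆ insert v s → x ≠ v → insert x S ⊆ s := by
      intro x hx hxv
      exact (Finset.subset_insert_iff_of_notMem (by simp [hvS, Ne.symm hxv])).1 hx
    obtain ⟨A, hAs, huA, hwA, hA⟩ := ih (hnot u hus huv) (hnot w hws hwv)
    -- Since `C` is a clique, once it meets `A` it lies in `A ∪ S`, and `v` may join `A`. Otherwise
    -- `v` has no neighbour in `A`.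
    by_cases hCA : ∃ c ∈ C, c ∈ A
    · obtain ⟨c, hcC, hcA⟩ := hCA
      refine ⟨insert v A, Finset.insert_subset_insert _ hAs, by simp [huA], by simp [hwv, hwA], ?_⟩
      intro a ha b hb hab
      rcases Finset.mem_insert.1 hb with rfl | hbs
      · simp
      rcases Finset.mem_insert.1 ha with rfl | ha
      · by_cases hbc : c = b
        · simp [← hbc, hcA]
        · exact (hA c hcA b hbs (hC.isClique hcC ((hadj b hbs).1 hab) hbc)).imp_left
            (Finset.mem_insert_of_mem ·)
      · exact (hA a ha b hbs hab).imp_left (Finset.mem_insert_of_mem ·)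
    · refine ⟨A, hAs.trans (Finset.subset_insert _ _), huA, hwA, ?_⟩
      intro a ha b hb hab
      rcases Finset.mem_insert.1 hb with rfl | hb
      · exact absurd ⟨a, (hadj a (hAs ha)).1 hab.symm, ha⟩ hCA
      · exact hA a ha b hb hab

/-- Any two `(k + 1)`-cliques of a `k`-tree are joined by a path in the `(k + 1)`-line graph. -/
theorem IsKTreeOn.reachable_lineGraph (h : IsKTreeOn G k s) :
    ∀ Q Q' : {t : Finset V // G.IsNClique (k + 1) t}, Q.1 ⊆ s → Q'.1 ⊆ s →
      (lineGraph G (k + 1)).Reachable Q Q' := by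
  induction h with
  | base s hs =>
    intro Q Q' hQ hQ'
    have h1 := Finset.eq_of_subset_of_card_le hQ (by rw [hs.card_eq, Q.2.card_eq])
    have h2 := Finset.eq_of_subset_of_card_le hQ' (by rw [hs.card_eq, Q'.2.card_eq])
    rw [Subtype.ext (h1.trans h2.symm)]
  | step s C v hs hv hCs hC hadj ih =>
    have hvC : v ∉ C := fun hvC => hv (hCs hvC)
    have hN := isNClique_insert_of_forall_adj hCs hC hadj
    -- `R` is an old clique that meets the new clique `insert v C` exactly in `C`; all paths are
    -- routed through it.
    obtain ⟨R, hRs, hCR, hR⟩ := hs.exists_isNClique_superset C hCs hC.isClique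
    have hvR : v ∉ R := fun hvR => hv (hRs hvR)
    have hNR : (lineGraph G (k + 1)).Adj ⟨insert v C, hN⟩ ⟨R, hR⟩ := by
      refine ⟨fun he => hvR ?_, ?_⟩
      · rw [Subtype.mk.injEq] at he
        exact he ▸ Finset.mem_insert_self v C
      · rw [Finset.insert_inter_of_notMem hvR, Finset.inter_eq_left.2 hCR, hC.card_eq]
    have hub : ∀ Q : {t : Finset V // G.IsNClique (k + 1) t}, Q.1 ⊆ insert v s →
        (lineGraph G (k + 1)).Reachable Q ⟨R, hR⟩ := by
      intro Q hQ
      by_cases hvQ : v ∈ Q.1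
      · have hQe : Q = ⟨insert v C, hN⟩ := Subtype.ext <|
          Finset.eq_of_subset_of_card_le (subset_insert_of_isClique Q.2.isClique hQ hvQ hadj)
            (by rw [hN.card_eq, Q.2.card_eq])
        exact hQe ▸ hNR.reachable
      · exact ih Q ⟨R, hR⟩ ((Finset.subset_insert_iff_of_notMem hvQ).1 hQ) hRs
    exact fun Q Q' hQ hQ' => (hub Q hQ).trans (hub Q' hQ').symm

theorem IsKTreeOn.exists_isNClique (h : IsKTreeOn G k s) : ∃ Q, G.IsNClique (k + 1) Q := by
  obtain ⟨Q, -, -, hQ⟩ := h.exists_isNClique_superset ∅ (Finset.empty_subset _) (by simp)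
  exact ⟨Q, hQ⟩

theorem card_inter_le_of_ne {Q Q' : Finset V} (hQ : G.IsNClique (k + 1) Q)
    (hQ' : G.IsNClique (k + 1) Q') (hne : Q ≠ Q') : (Q ∩ Q').card ≤ k := by
  by_contra! hlt
  have h1 : Q ∩ Q' = Q := Finset.eq_of_subset_of_card_le Finset.inter_subset_left
    (by rw [hQ.card_eq]; exact hlt)
  exact hne (Finset.eq_of_subset_of_card_le (Finset.inter_eq_left.1 h1)
    (by rw [hQ.card_eq, hQ'.card_eq]))

end Structure

/-! ### Reduced clique graph and clique trees of a `k`-tree. -/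

section Whole

variable {V : Type*} [Fintype V] [DecidableEq V] {G : SimpleGraph V} {k : ℕ}

/-- The maximal cliques of a `k`-tree are its `(k + 1)`-cliques. -/
theorem IsKTree.maximal_isClique_iff (hG : IsKTree G k) (Q : Finset V) :
    Maximal (fun s : Finset V => G.IsClique (s : Set V)) Q ↔ G.IsNClique (k + 1) Q := by
  constructor
  · intro hQ
    obtain ⟨R, -, hQR, hR⟩ := IsKTreeOn.exists_isNClique_superset hG Q (Finset.subset_univ _) hQ.1
    exact hQ.eq_of_le hR.isClique hQR ▸ hR
  · refine fun hQ => ⟨hQ.isClique, fun R hR hQR => ?_⟩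
    exact (Finset.eq_of_subset_of_card_le hQR
      (hQ.card_eq ▸ IsKTreeOn.card_le_of_isClique hG (Finset.subset_univ _) hR)).ge

/-- Two distinct `(k + 1)`-cliques of a `k`-tree form a separating pair if and only if they meet in
`k` vertices. -/
theorem IsKTree.isSeparatingPair_iff (hG : IsKTree G k) (hk : 1 ≤ k) {Q Q' : Finset V}
    (hQ : G.IsNClique (k + 1) Q) (hQ' : G.IsNClique (k + 1) Q') (hne : Q ≠ Q') :
    IsSeparatingPair G Q Q' ↔ (Q ∩ Q').card = k := by
  have hcard : (Q \ Q').card + (Q ∩ Q').card = k + 1 := by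
    rw [Finset.card_sdiff_add_card_inter, hQ.card_eq]
  have hcard' : (Q' \ Q).card + (Q ∩ Q').card = k + 1 := by
    rw [Finset.inter_comm, Finset.card_sdiff_add_card_inter, hQ'.card_eq]
  have hle := card_inter_le_of_ne hQ hQ' hne
  constructor
  · intro hsep
    by_contra hcon
    obtain ⟨u, hu⟩ := Finset.card_pos.1 (show 0 < (Q \ Q').card by omega)
    obtain ⟨w, hw⟩ := Finset.card_pos.1 (show 0 < (Q' \ Q).card by omega)
    obtain ⟨p, hp⟩ := IsKTreeOn.exists_walk_avoiding hG (lt_of_le_of_ne hle hcon)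
      u (by simp at hu ⊢; tauto) w (by simp at hw ⊢; tauto)
    obtain ⟨x, hx, hxS⟩ := hsep.2 u hu w hw p.bypass p.bypass_isPath
    exact hp x (p.support_bypass_subset_support hx) hxS
  · intro hS
    -- Nonemptiness of the intersection is where `1 ≤ k` enters.
    refine ⟨Finset.card_pos.1 (by omega), fun u hu w hw p _ => ?_⟩
    have hu1 : Q \ Q' = {u} := by
      obtain ⟨y, hy⟩ := Finset.card_eq_one.1 (show (Q \ Q').card = 1 by omega)
      rw [hy] at hu ⊢
      rw [Finset.mem_singleton.1 hu]
    have hw1 : Q' \ Q = {w} := by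
      obtain ⟨y, hy⟩ := Finset.card_eq_one.1 (show (Q' \ Q).card = 1 by omega)
      rw [hy] at hw ⊢
      rw [Finset.mem_singleton.1 hw]
    have hQe : insert u (Q ∩ Q') = Q := by
      rw [Finset.insert_eq, ← hu1, Finset.sdiff_union_inter]
    have hQe' : insert w (Q ∩ Q') = Q' := by
      rw [Finset.insert_eq, ← hw1, Finset.inter_comm, Finset.sdiff_union_inter]
    rw [Finset.mem_sdiff] at hu hw
    obtain ⟨A, -, huA, hwA, hA⟩ := IsKTreeOn.exists_separation hG hS
      (by simp [hu.2]) (by simp [hw.2]) (by rintro rfl; exact hu.2 hw.1)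
      (hQe.symm ▸ hQ.isClique) (hQe'.symm ▸ hQ'.isClique)
      (Finset.subset_univ _) (Finset.subset_univ _)
    by_contra! hcon
    -- The walk must leave `A` along some edge, whose far end can only lie in the separator.
    obtain ⟨d, hd, hdA, hdA'⟩ := p.exists_boundary_dart (A : Set V) huA hwA
    rcases hA _ hdA _ (Finset.mem_univ _) d.adj with h | h
    · exact hdA' h
    · exact hcon _ (p.dart_snd_mem_support_of_mem_darts hd) h

/-- The reduced clique graph of a `k`-tree is its `(k + 1)`-line graph. -/
def IsKTree.reducedCliqueGraphIso (hG : IsKTree G k) (hk : 1 ≤ k) :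
    reducedCliqueGraph G ≃g lineGraph G (k + 1) where
  toEquiv := Equiv.subtypeEquivRight hG.maximal_isClique_iff
  map_rel_iff' {Q Q'} := by
    have hQ := (hG.maximal_isClique_iff _).1 Q.2
    have hQ' := (hG.maximal_isClique_iff _).1 Q'.2
    simp only [lineGraph, reducedCliqueGraph, Equiv.subtypeEquivRight_apply_coe,
      EmbeddingLike.apply_eq_iff_eq, ne_eq, add_left_inj]
    exact and_congr_right fun hne =>
      (hG.isSeparatingPair_iff hk hQ hQ' fun h => hne (Subtype.ext h)).symm

theorem IsKTree.connected_lineGraph (hG : IsKTree G k) : (lineGraph G (k + 1)).Connected := by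
  obtain ⟨Q, hQ⟩ := IsKTreeOn.exists_isNClique hG
  have : Nonempty {t : Finset V // G.IsNClique (k + 1) t} := ⟨⟨Q, hQ⟩⟩
  exact ⟨fun R R' => IsKTreeOn.reachable_lineGraph hG R R'
    (Finset.subset_univ _) (Finset.subset_univ _)⟩

/-- Isomorphic graphs have equally many spanning trees. -/
theorem ncard_spanningTrees_eq_of_iso {W W' : Type*} {H : SimpleGraph W} {H' : SimpleGraph W'}
    (e : H ≃g H') : (spanningTrees H).ncard = (spanningTrees H').ncard := by
  rw [← Set.ncard_image_of_injective _ e.toEquiv.simpleGraph.injective]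
  congr 1
  ext T
  rw [Equiv.image_eq_preimage_symm, Set.mem_preimage]
  refine and_congr ⟨fun h a b hab => ?_, fun h a b hab => ?_⟩
    (SimpleGraph.Iso.comap e.toEquiv T).isTree_iff
  · have := @h (e.symm a) (e.symm b) (by simpa using hab)
    exact e.symm.map_adj_iff.1 this
  · exact e.map_adj_iff.1 (h hab)

/-- The clique trees of a `k`-tree are the spanning trees of its reduced clique graph. -/
theorem IsKTree.cliqueTrees_eq (hG : IsKTree G k) (hk : 1 ≤ k) :
    cliqueTrees G = spanningTrees (reducedCliqueGraph G) := by
  classical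
  have hnc : ∀ Q : MaxClique G, G.IsNClique (k + 1) Q.1 :=
    fun Q => (hG.maximal_isClique_iff _).1 Q.2
  have hle : reducedCliqueGraph G ≤ cliqueIntersectionGraph G := fun _ _ h => ⟨h.1, h.2.1⟩
  have hadj : ∀ Q Q' : MaxClique G, Q ≠ Q' →
      ((reducedCliqueGraph G).Adj Q Q' ↔ edgeWeight G s(Q, Q') = k) := fun Q Q' hne =>
    (and_iff_right hne).trans
      (hG.isSeparatingPair_iff hk (hnc Q) (hnc Q') fun h => hne (Subtype.ext h))
  have hwle : ∀ (T : SimpleGraph (MaxClique G)), ∀ e ∈ T.edgeFinset, edgeWeight G e ≤ k := by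
    intro T e
    induction e with | _ Q Q' =>
    intro he
    rw [SimpleGraph.mem_edgeFinset, SimpleGraph.mem_edgeSet] at he
    exact card_inter_le_of_ne (hnc Q) (hnc Q') fun h => he.ne (Subtype.ext h)
  have hcard : ∀ T : SimpleGraph (MaxClique G), T.IsTree →
      T.edgeFinset.card = Fintype.card (MaxClique G) - 1 := by
    intro T hT
    have := hT.card_edgeFinset
    omega
  have hub : ∀ T : SimpleGraph (MaxClique G), T.IsTree →
      totalWeight G T ≤ (Fintype.card (MaxClique G) - 1) * k := by
    intro T hT
    rw [← hcard T hT, ← smul_eq_mul]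
    exact Finset.sum_le_card_nsmul _ _ _ (hwle T)
  have hiff : ∀ T : SimpleGraph (MaxClique G), T.IsTree →
      (totalWeight G T = (Fintype.card (MaxClique G) - 1) * k ↔ T ≤ reducedCliqueGraph G) := by
    intro T hT
    rw [← hcard T hT, ← smul_eq_mul, ← Finset.sum_const, totalWeight,
      Finset.sum_eq_sum_iff_of_le (hwle T)]
    constructor
    · intro h Q Q' hQ
      exact (hadj Q Q' hQ.ne).2 (h s(Q, Q') (by simpa using hQ))
    · intro h e
      induction e with | _ Q Q' =>
      intro he
      rw [SimpleGraph.mem_edgeFinset, SimpleGraph.mem_edgeSet] at he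
      exact (hadj Q Q' he.ne).1 (h he)
  -- `T₀` shows that the upper bound is attained, so every maximum-weight tree attains it too.
  obtain ⟨T₀, hT₀, hT₀'⟩ :=
    ((hG.reducedCliqueGraphIso hk).connected_iff.2 hG.connected_lineGraph).exists_isTree_le
  ext T
  constructor
  · rintro ⟨⟨-, hT⟩, hmax⟩
    refine ⟨(hiff T hT).1 ((hub T hT).antisymm ?_), hT⟩
    exact (hiff T₀ hT₀').2 hT₀ ▸ hmax T₀ ⟨hT₀.trans hle, hT₀'⟩
  · rintro ⟨hTle, hT⟩
    refine ⟨⟨hTle.trans hle, hT⟩, fun T' hT' => ?_⟩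
    exact (hiff T hT).2 hTle ▸ hub T' hT'.2

end Whole

end KTree

theorem mainTheorem2 {V : Type*} [Fintype V] [DecidableEq V] (G : SimpleGraph V)
    (k : ℕ) (hk : 1 ≤ k) (hG : KTree.IsKTree G k) :
    (KTree.cliqueTrees G).ncard =
        (KTree.spanningTrees (KTree.reducedCliqueGraph G)).ncard ∧
      (KTree.cliqueTrees G).ncard =
        (KTree.spanningTrees (KTree.lineGraph G (k + 1))).ncard := by
  rw [hG.cliqueTrees_eq hk]
  exact ⟨rfl, KTree.ncard_spanningTrees_eq_of_iso (hG.reducedCliqueGraphIso hk)⟩
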